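/- Let $G$ be a finite directed graph with vertex set $V(G)$ and edge set $E(G)$; loops and multiple edges are allowed. A directed cycle in $G$ is a sequence $v_0,x_0,v_1,x_1,\dots,v_n,x_n,v_{n+1}=v_0$ ($n\ge 0$), taken up to cyclic rotation, where $v_0,\dots,v_n$ are pairwise distinct vertices and each $x_i$ is an edge from $v_i$ to $v_{i+1}$. For a vertex $u$ with outgoing edges $x_1,\dots,x_m$ and incoming edges $y_1,\dots,y_n$ put $k_u=\max\{m,n\}$ and, for $1\le l\le k_u$, $$\delta_{u,l}=e_l(x_1,\dots,x_m)-e_l(y_1,\dots,y_n)\in\mathbb Z[E(G)],$$ where $e_l$ is the $l$-th elementary symmetric polynomial ($e_l=0$ if $l$ exceeds the number of variables). Let $I(G)\subset\mathbb Z[E(G)]$ be the ideal generated by all $\delta_{u,l}$, $u\in V(G)$, $1\le l\le k_u$. Let $\mathscr C_*(G)$ be the Koszul chain complex over $\mathbb Z[E(G)]$ of the family $(\delta_{u,l})_{u,l}$, let $\mathscr H_*(G)$ be its homology, and let $\mathscr H^{\mathbb Q}_*(G)$ be the homology of $\mathbb Q\otimes_{\mathbb Z}\mathscr C_*(G)$.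 For a commutative ring $R$ and an $R$-module $M$ put $\operatorname{Kdim}_R M=\operatorname{Kdim}(R/\operatorname{ann}_R M)$, the Krull dimension of the ring $R/\operatorname{ann}_R M$. Let $v$ be a vertex of $G$ and let $E(v)$ be the set of edges incident at $v$. Let $\alpha_v(G)$ be the maximal number of pairwise edge-disjoint directed cycles in $G$ each of which contains $v$, and let $\beta_v(G)$ be the minimal number of edges in $E(v)$ whose removal from $G$ destroys all directed cycles containing $v$. 1. The following statements are equivalent: (1) there are no directed cycles in $G$ containing $v$; (2) $\mathbb Z[E(v)]/\operatorname{ann}_{\mathbb Z[E(v)]}(\mathscr H_0(G))$ is a finitely generated $\mathbb Z$-module; (3) $\mathbb Z[E(v)]/\operatorname{ann}_{\mathbb Z[E(v)]}(\mathscr H_*(G))$ is a finitely generated $\mathbb Z$-module; (4) there is an $n\ge 1$ such that $x^n\in I(G)$ for all $x\in E(v)$; (5) $\operatorname{Kdim}_{\mathbb Z[E(v)]}\mathscr H_0(G)=1$; (6) $\operatorname{Kdim}_{\mathbb Q[E(v)]}\mathscr H^{\mathbb Q}_0(G)=0$. 2. $\alpha_v(G)\le \operatorname{Kdim}_{\mathbb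 Q[E(v)]}\mathscr H_0^{\mathbb Q}(G)\le \operatorname{Kdim}_{\mathbb Z[E(v)]}\mathscr H_0(G)-1\le\beta_v(G)$. -/

import Mathlib

open CategoryTheory

universe u w

/-- A directed graph with vertex set `V` and edge set `E`.  Loops and multiple edges are allowed. -/
structure DirectedGraph (V : Type u) (E : Type w) where
  /-- initial vertex of an edge -/
  init : E → V
  /-- terminal vertex of an edge -/
  term : E → V

/-- A directed cycle `v₀, x₀, v₁, x₁, …, vₙ, xₙ, v₀`: pairwise distinct vertices, and `xᵢ` is an
edge from `vᵢ` to `vᵢ₊₁`.  The index `i + 1` is computed cyclically in `Fin (n + 1)`; for `n = 0`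
this is a loop.  The term records the cyclic sequence together with its starting point. -/
structure DirectedCycle {V : Type u} {E : Type w} (G : DirectedGraph V E) where
  n : ℕ
  vertex : Fin (n + 1) → V
  edge : Fin (n + 1) → E
  vertex_injective : Function.Injective vertex
  init_edge : ∀ i, G.init (edge i) = vertex i
  term_edge : ∀ i, G.term (edge i) = vertex (i + 1)

namespace DirectedCycle

variable {V : Type u} {E : Type w} {G : DirectedGraph V E}

/-- The directed cycle contains the vertex `v`. -/
def Contains (C : DirectedCycle G) (v : V) : Prop := ∃ i, C.vertex i = v

/-- The set of edges of a directed cycle. -/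
def edgeSet (C : DirectedCycle G) : Set E := Set.range C.edge

end DirectedCycle

namespace DirectedGraph

variable {V : Type u} {E : Type w}

/-- The set `E(v)` of all edges incident at `v`. -/
def incidentEdges (G : DirectedGraph V E) (v : V) : Set E := {x | G.init x = v ∨ G.term x = v}

/-- The graph obtained by removing the edges in `S`. -/
def deleteEdges (G : DirectedGraph V E) (S : Set E) : DirectedGraph V {x : E // x ∉ S} where
  init x := G.init x
  term x := G.term x

/-- No directed cycle of `G` contains `v`. -/
def NoCycleThrough (G : DirectedGraph V E) (v : V) : Prop :=
  ¬ ∃ C : DirectedCycle G, C.Contains v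

/-- `α_v(G)`: the maximal number of pairwise edge-disjoint directed cycles containing `v`.
Edge-disjoint directed cycles are automatically distinct, also up to rotation, because a
directed cycle and its rotations have the same non-empty edge set. -/
noncomputable def alpha (G : DirectedGraph V E) (v : V) : ℕ :=
  sSup {k : ℕ | ∃ C : Fin k → DirectedCycle G,
    (∀ i, (C i).Contains v) ∧ Pairwise fun i j => Disjoint (C i).edgeSet (C j).edgeSet}

/-- `β_v(G)`: the minimal number of edges incident at `v` whose removal from `G` destroys all
directed cycles containing `v`. -/
noncomputable def beta (G : DirectedGraph V E) (v : V) : ℕ :=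
  sInf {k : ℕ | ∃ S : Finset E, (S : Set E) ⊆ G.incidentEdges v ∧ S.card = k ∧
    (G.deleteEdges (S : Set E)).NoCycleThrough v}

end DirectedGraph

/-- The `l`-th elementary symmetric polynomial in the variables belonging to `S`. -/
noncomputable def esymmOn {E : Type w} (S : Finset E) (l : ℕ) : MvPolynomial E ℤ :=
  ∑ T ∈ S.powersetCard l, ∏ x ∈ T, MvPolynomial.X x

namespace DirectedGraph

variable {V : Type u} {E : Type w} [Fintype E] [DecidableEq V]

/-- The edges with initial vertex `v`. -/
def outEdges (G : DirectedGraph V E) (v : V) : Finset E := Finset.univ.filter fun x => G.init x = v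

/-- The edges with terminal vertex `v`. -/
def inEdges (G : DirectedGraph V E) (v : V) : Finset E := Finset.univ.filter fun x => G.term x = v

/-- `k_v`, the maximum of the out-degree and the in-degree of `v`. -/
def kmax (G : DirectedGraph V E) (v : V) : ℕ := max (G.outEdges v).card (G.inEdges v).card

/-- The index set of `Δ_G`: the pair `⟨v, l⟩` stands for `δ_{v, l + 1}`, where `1 ≤ l + 1 ≤ k_v`. -/
abbrev RelIndex (G : DirectedGraph V E) : Type u := Σ v : V, Fin (G.kmax v)

/-- The family `Δ_G` of all incidence relations. -/
noncomputable def incidenceRel (G : DirectedGraph V E) (p : G.RelIndex) : MvPolynomial E ℤ :=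
  esymmOn (G.outEdges p.1) (p.2 + 1) - esymmOn (G.inEdges p.1) (p.2 + 1)

/-- The incidence ideal `I(G)` of `ℤ[E(G)]`. -/
noncomputable def incidenceIdeal (G : DirectedGraph V E) : Ideal (MvPolynomial E ℤ) :=
  Ideal.span (Set.range G.incidenceRel)

end DirectedGraph

section Koszul

variable {R : Type w} [CommRing R] {ι : Type u}

/-- Contraction by a linear form maps `⋀ⁿ⁺¹ M` to `⋀ⁿ M`. -/
theorem contractLeft_mem_exteriorPower {M : Type*} [AddCommGroup M] [Module R M]
    (f : Module.Dual R M) (n : ℕ) (x : ExteriorAlgebra R M) (hx : x ∈ ⋀[R]^(n + 1) M) :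
    (CliffordAlgebra.contractLeft (Q := (0 : QuadraticForm R M)) f x : ExteriorAlgebra R M) ∈
      ⋀[R]^n M := by
  unfold ExteriorAlgebra.exteriorPower at hx ⊢
  induction n generalizing x with
  | zero =>
    rw [zero_add, pow_one] at hx
    obtain ⟨m, rfl⟩ := hx
    rw [ExteriorAlgebra.ι, CliffordAlgebra.contractLeft_ι, pow_zero]
    exact Submodule.algebraMap_mem _
  | succ n ih =>
    rw [pow_succ'] at hx
    refine Submodule.mul_induction_on hx ?_ ?_
    · rintro _ ⟨m, rfl⟩ b hb
      rw [ExteriorAlgebra.ι, CliffordAlgebra.contractLeft_ι_mul]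
      refine Submodule.sub_mem _ (Submodule.smul_mem _ _ hb) ?_
      rw [pow_succ']
      exact Submodule.mul_mem_mul ⟨m, rfl⟩ (ih b hb)
    · intro a b ha hb
      rw [map_add]
      exact Submodule.add_mem _ ha hb

/-- The Koszul boundary map `⋀ⁿ⁺¹ F → ⋀ⁿ F` on the free module `F` with basis `(e_i)`:
contraction by the linear form `e_i ↦ r i`, that is,
`e_{i₀} ∧ ⋯ ∧ e_{iₙ} ↦ ∑ j, (-1)^j r_{i_j} e_{i₀} ∧ ⋯ (omit e_{i_j}) ⋯ ∧ e_{iₙ}`. -/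
noncomputable def koszulD (r : ι → R) (n : ℕ) :
    ⋀[R]^(n + 1) (ι →₀ R) →ₗ[R] ⋀[R]^n (ι →₀ R) :=
  (CliffordAlgebra.contractLeft (Q := (0 : QuadraticForm R (ι →₀ R)))
    (Finsupp.linearCombination R r)).restrict
      (contractLeft_mem_exteriorPower (Finsupp.linearCombination R r) n)

theorem koszulD_comp (r : ι → R) (n : ℕ) : koszulD r n ∘ₗ koszulD r (n + 1) = 0 := by
  refine LinearMap.ext fun x => Subtype.ext ?_
  exact CliffordAlgebra.contractLeft_contractLeft _ (x : ExteriorAlgebra R (ι →₀ R))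

/-- The Koszul chain complex of the family `r`, i.e. the tensor product over `R` of the two-term
complexes `0 → R --(r i)--> R → 0`, with its standard basis `e_S`, `S ⊆ ι` finite. -/
noncomputable def koszulComplex (r : ι → R) : ChainComplex (ModuleCat.{max u w} R) ℕ :=
  ChainComplex.of (fun n => ModuleCat.of R (⋀[R]^n (ι →₀ R)))
    (fun n => ModuleCat.ofHom (koszulD r n))
    (fun n => by rw [← ModuleCat.ofHom_comp, koszulD_comp]; rfl)

end Koszul

/-- For a ring homomorphism `φ : S → R` and an `R`-module `M`, the annihilator in `S` of `M`
regarded as an `S`-module through `φ`, namely `{s | φ s • m = 0 for all m ∈ M}`. -/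
noncomputable def annVia {S R : Type*} [CommRing S] [CommRing R] (φ : S →+* R)
    (M : Type*) [AddCommGroup M] [Module R M] : Ideal S :=
  (Module.annihilator R M).comap φ

theorem mem_annVia {S R : Type*} [CommRing S] [CommRing R] (φ : S →+* R)
    (M : Type*) [AddCommGroup M] [Module R M] (s : S) :
    s ∈ annVia φ M ↔ ∀ m : M, φ s • m = 0 := by
  simp [annVia, Module.mem_annihilator]

/-- The Krull dimension `Kdim_S M` of `M` regarded as an `S`-module through `φ`. -/
noncomputable def krullDimVia {S R : Type*} [CommRing S] [CommRing R] (φ : S →+* R)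
    (M : Type*) [AddCommGroup M] [Module R M] : WithBot ℕ∞ :=
  ringKrullDim (S ⧸ annVia φ M)

/-- The inclusion `k[F] → k[E]` of polynomial rings for a subset `F` of `E`. -/
noncomputable def polyIncl {E : Type w} (k : Type) [CommRing k] (F : Set E) :
    MvPolynomial F k →+* MvPolynomial E k :=
  (MvPolynomial.rename (Subtype.val : F → E)).toRingHom

namespace DirectedGraph

variable {V : Type u} {E : Type w} [Fintype E] [DecidableEq V]

/-- The Khovanov–Rozansky chain complex over `ℤ[E(G)]`. -/
noncomputable def krComplex (G : DirectedGraph V E) :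
    ChainComplex (ModuleCat.{max u w} (MvPolynomial E ℤ)) ℕ :=
  koszulComplex G.incidenceRel

/-- The rational Khovanov–Rozansky chain complex `ℚ ⊗_ℤ C(G)`, written as
`ℚ[E(G)] ⊗_{ℤ[E(G)]} C(G)`; recall `ℚ[E(G)] = ℚ ⊗_ℤ ℤ[E(G)]`. -/
noncomputable def krComplexRat (G : DirectedGraph V E) :
    ChainComplex (ModuleCat.{max u w} (MvPolynomial E ℚ)) ℕ :=
  ((ModuleCat.extendScalars.{w, w, max u w}
    (MvPolynomial.map (σ := E) (Int.castRingHom ℚ))).mapHomologicalComplex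
      (ComplexShape.down ℕ)).obj G.krComplex

/-- The Khovanov–Rozansky homology in homological degree `n`. -/
noncomputable abbrev krHomology (G : DirectedGraph V E) (n : ℕ) :
    ModuleCat.{max u w} (MvPolynomial E ℤ) :=
  G.krComplex.homology n

/-- The total Khovanov–Rozansky homology, the direct sum over all homological degrees. -/
abbrev krHomologyTotal (G : DirectedGraph V E) : Type (max u w) :=
  DirectSum ℕ fun n => G.krHomology n

/-- The rational Khovanov–Rozansky homology in homological degree `n`. -/
noncomputable abbrev krHomologyRat (G : DirectedGraph V E) (n : ℕ) :
    ModuleCat.{max u w} (MvPolynomial E ℚ) :=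
  G.krComplexRat.homology n

/-- `ann_{ℤ[E(v)]} H_0(G)`. -/
noncomputable def annZero (G : DirectedGraph V E) (v : V) :
    Ideal (MvPolynomial (G.incidentEdges v) ℤ) :=
  annVia (polyIncl ℤ (G.incidentEdges v)) (G.krHomology 0)

/-- `ann_{ℤ[E(v)]} H_*(G)`. -/
noncomputable def annTotal (G : DirectedGraph V E) (v : V) :
    Ideal (MvPolynomial (G.incidentEdges v) ℤ) :=
  annVia (polyIncl ℤ (G.incidentEdges v)) G.krHomologyTotal

/-- `Kdim_{ℤ[E(v)]} H_0(G)`. -/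
noncomputable def kdimInt (G : DirectedGraph V E) (v : V) : WithBot ℕ∞ :=
  krullDimVia (polyIncl ℤ (G.incidentEdges v)) (G.krHomology 0)

/-- `Kdim_{ℚ[E(v)]} H_0^ℚ(G)`. -/
noncomputable def kdimRat (G : DirectedGraph V E) (v : V) : WithBot ℕ∞ :=
  krullDimVia (polyIncl ℚ (G.incidentEdges v)) (G.krHomologyRat 0)

end DirectedGraph

/-!
Exterior multiplication is a homotopy showing that `I(G)` kills all Koszul homology, while
`H_0 = ℤ[E(G)] / I(G)`; so every annihilator in question is `I(G) ∩ ℤ[E(v)]`, and rationally the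
contraction of the extension of `I(G)`.

Over an integral domain, elementary symmetric functions determine the multiset of their nonzero
arguments. Hence a ring homomorphism `φ` to a domain kills `I(G)` if and only if, for every `t ≠ 0`,
the set of edges `x` with `φ x = t` is balanced: at each vertex as many of its edges start as end.
An edge of a balanced set always lies on a directed cycle inside the set.

Giving disjoint cycles independent values yields a surjection of `ℚ[E(v)] / ann H_0^ℚ` onto a
polynomial ring in `α_v` variables. Conversely, if removing `S` destroys all cycles through `v`,
then in each residue domain of `I(G)` an edge `x` at `v` is either `0` or equal to some `s ∈ S`: the
level set of its value would otherwise contain a cycle avoiding `S`. So `x ∏ s ∈ S, (x - s)` is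
nilpotent modulo `I(G)`, and `ℤ[E(v)] / ann H_0` is integral over the subring generated by `S`.
Finally, by the Nullstellensatz over `ℤ`, a prime of the generic fibre is never maximal in
`ℤ[E(v)]`, so that passing to `ℚ` lowers the Krull dimension by at least one.
-/

section ElementarySymmetric

theorem esymm_add_replicate_zero {R : Type*} [CommSemiring R] (s : Multiset R) (k l : ℕ) :
    (s + Multiset.replicate k 0).esymm l = s.esymm l := by
  induction k with
  | zero => simp
  | succ k ih =>
    rw [Multiset.replicate_succ, Multiset.add_cons, ← ih]
    cases l with
    | zero => simp [Multiset.esymm]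
    | succ l => simp [Multiset.esymm, Multiset.powersetCard_cons]

variable {K : Type*} [CommRing K] [IsDomain K]

theorem eq_of_card_eq_of_esymm_eq {s t : Multiset K} (hcard : s.card = t.card)
    (h : ∀ l, s.esymm l = t.esymm l) : s = t := by
  have hprod : (s.map fun a => Polynomial.X - Polynomial.C a).prod =
      (t.map fun a => Polynomial.X - Polynomial.C a).prod := by
    simp only [Multiset.prod_X_sub_X_eq_sum_esymm, hcard, h]
  rw [← Polynomial.roots_multiset_prod_X_sub_C s, hprod, Polynomial.roots_multiset_prod_X_sub_C]

theorem forall_esymm_eq_iff_forall_count_eq [DecidableEq K] {s t : Multiset K} :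
    (∀ l, s.esymm l = t.esymm l) ↔ ∀ a ≠ 0, s.count a = t.count a := by
  constructor
  · intro h a ha
    have hpad : s + Multiset.replicate t.card 0 = t + Multiset.replicate s.card 0 :=
      eq_of_card_eq_of_esymm_eq (by simp [add_comm]) fun l => by
        rw [esymm_add_replicate_zero, esymm_add_replicate_zero, h]
    simpa [Multiset.count_replicate, ha.symm] using congrArg (Multiset.count a) hpad
  · intro h l
    have hpad : s + Multiset.replicate (t.count 0) 0 = t + Multiset.replicate (s.count 0) 0 := by
      ext a
      rcases eq_or_ne a 0 with rfl | ha
      · simp [add_comm]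
      · simp [Multiset.count_replicate, ha.symm, h a ha]
    rw [← esymm_add_replicate_zero s (t.count 0), hpad, esymm_add_replicate_zero]

end ElementarySymmetric

section BalancedEdgeSets

open Relation

theorem exists_injective_path {α : Type*} {r : α → α → Prop} {a b : α}
    (h : ReflTransGen r a b) :
    ∃ (n : ℕ) (p : Fin (n + 1) → α), Function.Injective p ∧ p 0 = a ∧ p (Fin.last n) = b ∧
      ∀ i : Fin n, r (p i.castSucc) (p i.succ) := by
  induction h with
  | refl => exact ⟨0, fun _ => a, fun i j _ => Subsingleton.elim (α := Fin 1) i j, rfl, rfl, nofun⟩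
  | @tail b c _ hbc ih =>
    obtain ⟨n, p, hinj, hfirst, hlast, hstep⟩ := ih
    by_cases hc : ∃ j, p j = c
    · obtain ⟨j, hj⟩ := hc
      have hle : (j : ℕ) + 1 ≤ n + 1 := j.2
      refine ⟨j, p ∘ Fin.castLE hle, hinj.comp (Fin.castLE_injective hle), hfirst, hj, fun i => ?_⟩
      exact hstep ⟨i, by omega⟩
    · refine ⟨n + 1, Fin.snoc p c, Fin.snoc_injective_iff.2 ⟨hinj, hc⟩, ?_, Fin.snoc_last _ _,
        fun i => ?_⟩
      · rw [← Fin.castSucc_zero, Fin.snoc_castSucc, hfirst]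
      · rw [Fin.snoc_castSucc]
        induction i using Fin.lastCases with
        | last => rwa [Fin.succ_last, Fin.snoc_last, hlast]
        | cast i => rw [Fin.succ_castSucc, Fin.snoc_castSucc]; exact hstep i

theorem DirectedCycle.edge_injective {V E : Type*} {G : DirectedGraph V E} (C : DirectedCycle G) :
    Function.Injective C.edge :=
  fun i j hij => C.vertex_injective <| by rw [← C.init_edge, hij, C.init_edge]

namespace DirectedGraph

variable {V : Type*} {E : Type*} {G : DirectedGraph V E} {F : Finset E}

/-- A finite edge set is balanced if at every vertex as many of its edges start as end, i.e. if its
initial and its terminal vertices agree as multisets. -/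
def IsBalanced (G : DirectedGraph V E) (F : Finset E) : Prop :=
  F.val.map G.init = F.val.map G.term

theorem IsBalanced.card_filter_init_eq (hF : G.IsBalanced F) (p : V → Prop) [DecidablePred p] :
    (F.filter fun x => p (G.init x)).card = (F.filter fun x => p (G.term x)).card := by
  simpa only [Multiset.countP_map, ← Finset.filter_val, ← Finset.card_def] using
    congrArg (Multiset.countP p) hF

theorem isBalanced_iff [DecidableEq V] : G.IsBalanced F ↔
    ∀ u, (F.filter fun x => G.init x = u).card = (F.filter fun x => G.term x = u).card := by
  refine ⟨fun hF u => hF.card_filter_init_eq (· = u), fun h => Multiset.ext' fun u => ?_⟩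
  simpa only [Multiset.count_map, eq_comm (a := u), ← Finset.filter_val, ← Finset.card_def]
    using h u

theorem isBalanced_of_coe_eq_edgeSet (C : DirectedCycle G) (hF : (F : Set E) = C.edgeSet) :
    G.IsBalanced F := by
  have hF' : F = Finset.univ.map ⟨C.edge, C.edge_injective⟩ :=
    Finset.coe_injective <| by simp [hF, DirectedCycle.edgeSet]
  have hshift : Finset.univ.val.map (· + 1) = (Finset.univ : Finset (Fin (C.n + 1))).val :=
    Multiset.map_univ_val_equiv (Equiv.addRight 1)
  rw [IsBalanced, hF', Finset.map_val, Multiset.map_map, Multiset.map_map]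
  simp only [Function.Embedding.coeFn_mk, Function.comp_def, C.init_edge, C.term_edge]
  rw [← Function.comp_def C.vertex (· + 1), ← Multiset.map_map, hshift]

/-- The vertex `b` is reached from `a` along a single edge lying in `F`; directed cycles inside `F`
are extracted from the reflexive transitive closure of this relation. -/
def AdjIn (G : DirectedGraph V E) (F : Set E) (a b : V) : Prop :=
  ∃ x ∈ F, G.init x = a ∧ G.term x = b

theorem IsBalanced.reflTransGen_adjIn (hF : G.IsBalanced F) {x : E} (hx : x ∈ F) :
    ReflTransGen (G.AdjIn F) (G.term x) (G.init x) := by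
  classical
  -- No edge of `F` leaves the set of vertices reachable from `G.term x`, so by balance none of them
  -- enters it from outside.
  let Reachable : V → Prop := ReflTransGen (G.AdjIn F) (G.term x)
  have hsub : F.filter (fun y => Reachable (G.init y)) ⊆ F.filter fun y => Reachable (G.term y) :=
    Finset.monotone_filter_right F fun y hy hreach => hreach.tail ⟨y, hy, rfl, rfl⟩
  have heq := Finset.eq_of_subset_of_card_le hsub (hF.card_filter_init_eq Reachable).ge
  have hmem : x ∈ F.filter fun y => Reachable (G.init y) := by
    rw [heq]
    exact Finset.mem_filter.2 ⟨hx, ReflTransGen.refl⟩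
  exact (Finset.mem_filter.1 hmem).2

theorem exists_cycle_of_reflTransGen {F : Set E} {x : E} (hx : x ∈ F)
    (h : ReflTransGen (G.AdjIn F) (G.term x) (G.init x)) :
    ∃ C : DirectedCycle G, C.Contains (G.init x) ∧ C.Contains (G.term x) ∧ C.edgeSet ⊆ F := by
  obtain ⟨n, p, hinj, hfirst, hlast, hstep⟩ := exists_injective_path h
  have hadj : ∀ i, G.AdjIn F (p i) (p (i + 1)) := by
    intro i
    induction i using Fin.lastCases with
    | last => rw [Fin.last_add_one, hfirst, hlast]; exact ⟨x, hx, rfl, rfl⟩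
    | cast i => rw [Fin.coeSucc_eq_succ]; exact hstep i
  choose e heF hinit hterm using hadj
  exact ⟨⟨n, p, e, hinj, hinit, hterm⟩, ⟨_, hlast⟩, ⟨_, hfirst⟩, Set.range_subset_iff.2 heF⟩

theorem IsBalanced.exists_cycle (hF : G.IsBalanced F) {v : V} {x : E} (hx : x ∈ F)
    (hxv : x ∈ G.incidentEdges v) : ∃ C : DirectedCycle G, C.Contains v ∧ C.edgeSet ⊆ F := by
  obtain ⟨C, hinit, hterm, hCF⟩ := exists_cycle_of_reflTransGen hx (hF.reflTransGen_adjIn hx)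
  rcases hxv with rfl | rfl
  exacts [⟨C, hinit, hCF⟩, ⟨C, hterm, hCF⟩]

end DirectedGraph

end BalancedEdgeSets

section IncidenceVariety

theorem map_esymmOn {E K : Type*} [CommRing K] (φ : MvPolynomial E ℤ →+* K) (S : Finset E) (l : ℕ) :
    φ (esymmOn S l) = (S.val.map fun x => φ (MvPolynomial.X x)).esymm l := by
  rw [Finset.esymm_map_val, esymmOn, map_sum]
  exact Finset.sum_congr rfl fun T _ => map_prod φ _ T

namespace DirectedGraph

variable {V E : Type*} [Fintype E] [DecidableEq V] {G : DirectedGraph V E} {K : Type*} [CommRing K]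
  {φ : MvPolynomial E ℤ →+* K}

theorem esymmOn_outEdges_eq_of_kmax_lt {u : V} {l : ℕ} (hl : G.kmax u < l) :
    esymmOn (G.outEdges u) l = esymmOn (G.inEdges u) l := by
  rw [kmax, max_lt_iff] at hl
  rw [esymmOn, esymmOn, Finset.powersetCard_eq_empty.2 hl.1, Finset.powersetCard_eq_empty.2 hl.2]

theorem incidenceIdeal_le_ker_iff : G.incidenceIdeal ≤ RingHom.ker φ ↔
    ∀ u l, φ (esymmOn (G.outEdges u) l) = φ (esymmOn (G.inEdges u) l) := by
  simp only [incidenceIdeal, Ideal.span_le, Set.range_subset_iff, SetLike.mem_coe, RingHom.mem_ker,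
    incidenceRel, map_sub, sub_eq_zero]
  refine ⟨fun h u l => ?_, fun h p => h p.1 _⟩
  rcases l with _ | l
  · simp only [esymmOn, Finset.powersetCard_zero]
  · rcases lt_or_ge l (G.kmax u) with hl | hl
    · exact h ⟨u, l, hl⟩
    · rw [esymmOn_outEdges_eq_of_kmax_lt (Nat.lt_succ_of_le hl)]

variable [IsDomain K]

theorem incidenceIdeal_le_ker_iff_isBalanced [DecidableEq K] : G.incidenceIdeal ≤ RingHom.ker φ ↔
    ∀ t ≠ 0, G.IsBalanced {x | φ (MvPolynomial.X x) = t} := by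
  have hcount (A : Finset E) (t : K) :
      (A.val.map fun x => φ (MvPolynomial.X x)).count t =
        (A.filter fun x => φ (MvPolynomial.X x) = t).card := by
    rw [Multiset.count_map, ← Finset.filter_val, ← Finset.card_def]
    simp only [eq_comm]
  simp only [incidenceIdeal_le_ker_iff, map_esymmOn, forall_esymm_eq_iff_forall_count_eq,
    isBalanced_iff, hcount, outEdges, inEdges, Finset.filter_filter, and_comm]
  exact ⟨fun h t ht u => h u t ht, fun h u t ht => h t ht u⟩

theorem X_eq_zero_or_exists_X_eq (hφ : G.incidenceIdeal ≤ RingHom.ker φ) {v : V} {S : Finset E}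
    (hS : (G.deleteEdges (S : Set E)).NoCycleThrough v) {x : E} (hx : x ∈ G.incidentEdges v) :
    φ (.X x) = 0 ∨ ∃ s ∈ S, φ (.X x) = φ (.X s) := by
  classical
  by_contra! h
  obtain ⟨C, hCv, hC⟩ :=
    (incidenceIdeal_le_ker_iff_isBalanced.1 hφ _ h.1).exists_cycle (by simp) hx
  have hmem : ∀ i, C.edge i ∉ (S : Set E) := fun i hi =>
    h.2 _ hi (Finset.mem_filter.1 (hC ⟨i, rfl⟩)).2.symm
  exact hS ⟨⟨C.n, C.vertex, fun i => ⟨C.edge i, hmem i⟩, C.vertex_injective, C.init_edge,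
    C.term_edge⟩, hCv⟩

theorem X_mul_prod_sub_mem_radical {v : V} {S : Finset E}
    (hS : (G.deleteEdges (S : Set E)).NoCycleThrough v) {x : E} (hx : x ∈ G.incidentEdges v) :
    (.X x * ∏ s ∈ S, (.X x - .X s) : MvPolynomial E ℤ) ∈ G.incidenceIdeal.radical := by
  rw [Ideal.radical_eq_sInf, Submodule.mem_sInf]
  rintro P ⟨hIP, hP⟩
  have hmem := X_eq_zero_or_exists_X_eq (φ := Ideal.Quotient.mk P) (by rwa [Ideal.mk_ker]) hS hx
  simpa only [← Ideal.Quotient.eq_zero_iff_mem, map_mul, map_prod, map_sub, mul_eq_zero,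
    Finset.prod_eq_zero_iff, sub_eq_zero] using hmem

end DirectedGraph

namespace DirectedCycle

variable {V E ι M : Type*} [Fintype ι] [AddCommMonoid M] {G : DirectedGraph V E}
  {C : ι → DirectedCycle G} {a : ι → M}

open scoped Classical in
/-- The edge weight with constant value `a i` along the cycle `C i` and `0` off the cycles; for
edge-disjoint cycles and suitable values it is a point of the incidence variety. -/
noncomputable def weight (C : ι → DirectedCycle G) (a : ι → M) (x : E) : M :=
  ∑ i, if x ∈ (C i).edgeSet then a i else 0

theorem weight_of_mem (hC : Pairwise fun i j => Disjoint (C i).edgeSet (C j).edgeSet) {x : E}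
    {i : ι} (hx : x ∈ (C i).edgeSet) : weight C a x = a i := by
  rw [weight, Finset.sum_eq_single i, if_pos hx]
  · exact fun j _ hj => if_neg fun h => Set.disjoint_left.1 (hC hj) h hx
  · simp

theorem weight_of_forall_notMem {x : E} (hx : ∀ i, x ∉ (C i).edgeSet) : weight C a x = 0 :=
  Finset.sum_eq_zero fun i _ => if_neg (hx i)

theorem isBalanced_weight_eq [Fintype E] [DecidableEq M]
    (hC : Pairwise fun i j => Disjoint (C i).edgeSet (C j).edgeSet)
    (ha : Function.Injective a) {t : M} (ht : t ≠ 0) :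
    G.IsBalanced {x | weight C a x = t} := by
  have hexists {x : E} (hx : weight C a x = t) : ∃ i, x ∈ (C i).edgeSet := by
    by_contra! h
    exact ht (hx ▸ weight_of_forall_notMem h)
  by_cases h : ∃ i, a i = t
  · obtain ⟨i, rfl⟩ := h
    refine DirectedGraph.isBalanced_of_coe_eq_edgeSet (C i) (Set.ext fun x => ?_)
    rw [Finset.coe_filter_univ, Set.mem_ofPred_eq]
    refine ⟨fun hx => ?_, weight_of_mem hC⟩
    obtain ⟨j, hj⟩ := hexists hx
    rwa [← ha ((weight_of_mem hC hj).symm.trans hx)]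
  · rw [Finset.filter_false_of_mem]
    · rfl
    · intro x _ hx
      obtain ⟨i, hi⟩ := hexists hx
      exact h ⟨i, (weight_of_mem hC hi).symm.trans hx⟩

end DirectedCycle

end IncidenceVariety

section KoszulHomology

open Limits TensorProduct

/-- Homology in degree `0` of a chain complex indexed by `ℕ`, as the cokernel of the last
differential. -/
noncomputable def homologyZeroIsoCokernel {C : Type*} [Category* C] [Abelian C]
    (K : ChainComplex C ℕ) : K.homology 0 ≅ cokernel (K.d 1 0) :=
  K.isoHomologyι₀ ≪≫ (K.opcyclesIsCokernel 1 0 (by simp)).coconePointUniqueUpToIso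
    (colimit.isColimit _)

/-- A right exact functor commutes with homology in degree `0`; used for extension of scalars. -/
noncomputable def homologyZeroMapIso {C D : Type*} [Category* C] [Category* D] [Abelian C]
    [Abelian D] (F : C ⥤ D) [F.PreservesZeroMorphisms] [PreservesFiniteColimits F]
    (K : ChainComplex C ℕ) :
    ((F.mapHomologicalComplex (ComplexShape.down ℕ)).obj K).homology 0 ≅ F.obj (K.homology 0) :=
  homologyZeroIsoCokernel _ ≪≫ (PreservesCokernel.iso F (K.d 1 0)).symm ≪≫
    F.mapIso (homologyZeroIsoCokernel K).symm

theorem annihilator_extendScalars {R S : Type w} [CommRing R] [CommRing S] (φ : R →+* S)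
    (M : ModuleCat.{max u w} R) {I : Ideal R} (e : M ≃ₗ[R] R ⧸ I) :
    Module.annihilator S ((ModuleCat.extendScalars.{w, w, max u w} φ).obj M) = I.map φ := by
  let _ := φ.toAlgebra
  have e' : S ⊗[R] M ≃ₗ[S] S ⧸ I.map φ := (e.baseChange R S M (R ⧸ I)).trans
    (Algebra.TensorProduct.quotIdealMapEquivTensorQuot S I).symm.toLinearEquiv
  exact e'.annihilator_eq.trans Ideal.annihilator_quotient

theorem mem_annihilator_homology {R : Type*} [CommRing R] {K : ChainComplex (ModuleCat R) ℕ}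
    {n : ℕ} {a : R}
    (h : ∀ x : K.X n, (∀ m, K.d n m x = 0) → ∃ y : K.X (n + 1), K.d (n + 1) n y = a • x) :
    a ∈ Module.annihilator R (K.homology n) := by
  rw [Module.mem_annihilator]
  intro m
  obtain ⟨c, rfl⟩ := (ModuleCat.epi_iff_surjective (K.homologyπ n)).1 inferInstance m
  obtain ⟨y, hy⟩ := h (K.iCycles n c) fun m => by
    rw [← ModuleCat.comp_apply, K.iCycles_d]; rfl
  have hc : K.toCycles (n + 1) n y = a • c := by
    apply (ModuleCat.mono_iff_injective (K.iCycles n)).1 inferInstance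
    rw [← ModuleCat.comp_apply, K.toCycles_i, hy, map_smul]
  rw [← map_smul, ← hc, ← ModuleCat.comp_apply, K.toCycles_comp_homologyπ]
  rfl

section Wedge

variable {R M : Type*} [CommRing R] [AddCommGroup M] [Module R M]

/-- Left exterior multiplication by `m`, the contracting homotopy of the Koszul complex up to the
value of the form at `m`. -/
noncomputable def wedgeLeft (m : M) (n : ℕ) : ⋀[R]^n M →ₗ[R] ⋀[R]^(n + 1) M :=
  (LinearMap.mulLeft R (ExteriorAlgebra.ι R m)).restrict fun z hz => by
    rw [ExteriorAlgebra.exteriorPower, pow_succ']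
    exact Submodule.mul_mem_mul (LinearMap.mem_range_self _ m) hz

theorem coe_wedgeLeft (m : M) {n : ℕ} (z : ⋀[R]^n M) :
    (wedgeLeft m n z : ExteriorAlgebra R M) = ExteriorAlgebra.ι R m * z :=
  rfl

theorem contractLeft_eq_zero_of_mem_exteriorPower_zero (f : Module.Dual R M) (z : ⋀[R]^0 M) :
    CliffordAlgebra.contractLeft (Q := (0 : QuadraticForm R M)) f
      (z : ExteriorAlgebra R M) = 0 := by
  obtain ⟨c, hc⟩ := Submodule.mem_one.1 ((pow_zero (LinearMap.range (ExteriorAlgebra.ι R))).le z.2)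
  exact hc ▸ CliffordAlgebra.contractLeft_algebraMap (0 : QuadraticForm R M) f c

end Wedge

variable {R : Type w} [CommRing R] {ι : Type u} (r : ι → R)

theorem coe_koszulD {n : ℕ} (z : ⋀[R]^(n + 1) (ι →₀ R)) :
    (koszulD r n z : ExteriorAlgebra R (ι →₀ R)) = CliffordAlgebra.contractLeft
      (Q := (0 : QuadraticForm R (ι →₀ R))) (Finsupp.linearCombination R r)
        (z : ExteriorAlgebra R (ι →₀ R)) :=
  rfl

theorem koszulComplex_d (n : ℕ) :
    (koszulComplex r).d (n + 1) n = ModuleCat.ofHom (koszulD r n) :=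
  ChainComplex.of_d (fun n => ModuleCat.of R (⋀[R]^n (ι →₀ R)))
    (fun n => ModuleCat.ofHom (koszulD r n)) n

variable {r}

theorem koszulD_wedgeLeft {n : ℕ} {z : ⋀[R]^n (ι →₀ R)}
    (hz : CliffordAlgebra.contractLeft (Q := (0 : QuadraticForm R (ι →₀ R)))
      (Finsupp.linearCombination R r) (z : ExteriorAlgebra R (ι →₀ R)) = 0) (m : ι →₀ R) :
    koszulD r n (wedgeLeft m n z) = Finsupp.linearCombination R r m • z := by
  refine Subtype.ext ?_
  rw [coe_koszulD, coe_wedgeLeft, ExteriorAlgebra.ι, CliffordAlgebra.contractLeft_ι_mul, hz,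
    mul_zero, sub_zero, Submodule.coe_smul]

theorem span_le_annihilator_homology_koszulComplex (n : ℕ) :
    Ideal.span (Set.range r) ≤ Module.annihilator R ((koszulComplex r).homology n) := by
  rw [Ideal.span, ← Finsupp.range_linearCombination]
  rintro _ ⟨m, rfl⟩
  refine mem_annihilator_homology fun z hz => ⟨wedgeLeft m n z, ?_⟩
  rw [koszulComplex_d]
  refine koszulD_wedgeLeft ?_ m
  rcases n with _ | n
  · exact contractLeft_eq_zero_of_mem_exteriorPower_zero _ z
  · have hzn := hz n
    rw [koszulComplex_d] at hzn
    exact congrArg Subtype.val hzn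

theorem zeroEquiv_koszulD (z : ⋀[R]^1 (ι →₀ R)) :
    exteriorPower.zeroEquiv R (ι →₀ R) (koszulD r 0 z) =
      Finsupp.linearCombination R r (exteriorPower.oneEquiv R (ι →₀ R) z) := by
  obtain ⟨m, rfl⟩ := (exteriorPower.oneEquiv R (ι →₀ R)).symm.surjective z
  rw [LinearEquiv.apply_symm_apply, ← LinearEquiv.eq_symm_apply]
  refine Subtype.ext ?_
  rw [coe_koszulD, exteriorPower.oneEquiv_symm_apply, exteriorPower.zeroEquiv_symm_apply,
    Submodule.coe_smul, exteriorPower.ιMulti_apply_coe, exteriorPower.ιMulti_apply_coe,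
    ExteriorAlgebra.ιMulti_zero_apply, ExteriorAlgebra.ιMulti_apply, List.ofFn_succ, List.ofFn_zero,
    List.prod_singleton, ExteriorAlgebra.ι, CliffordAlgebra.contractLeft_ι,
    Algebra.algebraMap_eq_smul_one]

theorem map_zeroEquiv_range_koszulD :
    (LinearMap.range (koszulD r 0)).map (exteriorPower.zeroEquiv R (ι →₀ R)).toLinearMap =
      Ideal.span (Set.range r) := by
  have h : (exteriorPower.zeroEquiv R (ι →₀ R)).toLinearMap ∘ₗ koszulD r 0 =
      Finsupp.linearCombination R r ∘ₗ (exteriorPower.oneEquiv R (ι →₀ R)).toLinearMap :=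
    LinearMap.ext zeroEquiv_koszulD
  rw [← LinearMap.range_comp, h, LinearMap.range_comp, LinearEquiv.range, Submodule.map_top,
    Finsupp.range_linearCombination, Ideal.span]

variable (r) in
/-- The zeroth Koszul homology as the cyclic module presented by the family `r`. -/
noncomputable def homologyZeroKoszulComplexEquiv :
    (koszulComplex r).homology 0 ≃ₗ[R] R ⧸ Ideal.span (Set.range r) :=
  (homologyZeroIsoCokernel _ ≪≫ ModuleCat.cokernelIsoRangeQuotient _).toLinearEquiv.trans
    (Submodule.Quotient.equiv _ _ (exteriorPower.zeroEquiv R (ι →₀ R)) <| by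
      rw [koszulComplex_d]; exact map_zeroEquiv_range_koszulD)

theorem annihilator_homology_zero_koszulComplex :
    Module.annihilator R ((koszulComplex r).homology 0) = Ideal.span (Set.range r) := by
  rw [(homologyZeroKoszulComplexEquiv r).annihilator_eq, Ideal.annihilator_quotient]

theorem annihilator_directSum_homology_koszulComplex :
    Module.annihilator R (DirectSum ℕ fun n => (koszulComplex r).homology n) =
      Ideal.span (Set.range r) := by
  refine (Module.annihilator_dfinsupp ..).trans (le_antisymm ?_ ?_)
  · exact (iInf_le _ 0).trans annihilator_homology_zero_koszulComplex.le
  · exact le_iInf span_le_annihilator_homology_koszulComplex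

theorem annihilator_homology_zero_extendScalars_koszulComplex {S : Type w} [CommRing S]
    (φ : R →+* S) : Module.annihilator S
      ((((ModuleCat.extendScalars.{w, w, max u w} φ).mapHomologicalComplex
        (ComplexShape.down ℕ)).obj (koszulComplex r)).homology 0) =
      (Ideal.span (Set.range r)).map φ := by
  have := (ModuleCat.extendRestrictScalarsAdj.{max u w} φ).leftAdjoint_preservesColimits
  rw [(homologyZeroMapIso _ _).toLinearEquiv.annihilator_eq]
  exact annihilator_extendScalars φ _ (homologyZeroKoszulComplexEquiv r)

end KoszulHomology

section KrullDimension

theorem krullDim_add_one_le_of_strictMono {α β : Type*} [Preorder α] [Preorder β] (f : α → β)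
    (hf : StrictMono f) (h : ∀ a, ∃ b, f a < b) :
    Order.krullDim α + 1 ≤ Order.krullDim β := by
  cases isEmpty_or_nonempty α
  · simp [Order.krullDim_eq_bot]
  have : Nonempty β := Nonempty.map f inferInstance
  rw [Order.krullDim_eq_iSup_length, Order.krullDim_eq_iSup_length, ← WithBot.coe_one,
    ← WithBot.coe_add, ENat.iSup_add, WithBot.coe_le_coe, iSup_le_iff]
  intro l
  obtain ⟨b, hb⟩ := h l.last
  refine le_trans ?_ (le_iSup _ ((l.map f hf).snoc b hb))
  simp [RelSeries.snoc, RelSeries.append, LTSeries.map]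

theorem ringKrullDim_le_of_isIntegral (A B : Type*) [CommRing A] [CommRing B] [Algebra A B]
    [Algebra.IsIntegral A B] : ringKrullDim B ≤ ringKrullDim A :=
  Order.krullDim_le_of_strictMono (PrimeSpectrum.comap (algebraMap A B)) fun p q h =>
    Ideal.IsIntegral.comap_lt_comap (I := p.asIdeal) (J := q.asIdeal) h

instance isJacobsonRing_int : IsJacobsonRing ℤ := by
  rw [isJacobsonRing_iff_prime_eq]
  intro P hP
  by_cases h : P = ⊥
  · subst h
    refine le_antisymm (fun x hx => ?_) Ideal.le_jacobson
    -- For `x ≠ 0` the integer `3x² + 1` is greater than `1`, hence not a unit.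
    have hunit := Int.isUnit_iff.1 (Ideal.mem_jacobson_bot.1 hx (3 * x))
    rw [Ideal.mem_bot]
    rcases hunit with h | h <;> nlinarith [sq_nonneg x]
  · exact Ideal.jacobson_eq_self_of_isMaximal (H := hP.isMaximal h)

variable {A R S : Type*} [CommRing A] [CommRing R] [CommRing S] [Algebra A R] [Algebra R S]

theorem isMaximal_under_of_finiteType [IsJacobsonRing A] [Algebra.FiniteType A R] (P : Ideal R)
    [P.IsMaximal] : (P.under A).IsMaximal := by
  let _ := Ideal.Quotient.field P
  have : Module.Finite A (R ⧸ P) := finite_of_finite_type_of_isJacobsonRing A (R ⧸ P)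
  have hker : RingHom.ker (algebraMap A (R ⧸ P)) = P.under A := by
    ext a
    exact Ideal.Quotient.eq_zero_iff_mem
  rw [← hker]
  exact Algebra.ker_algebraMap_isMaximal_of_isIntegral A (R ⧸ P)

/-- A prime ideal of the generic fibre `S` contracts to a prime ideal of `R` meeting `A` trivially,
which is not maximal by the Nullstellensatz; so a chain can be prolonged. -/
theorem ringKrullDim_quotient_add_one_le_of_isLocalization [IsDomain A] [IsJacobsonRing A]
    [Algebra.FiniteType A R] (hA : ¬ IsField A)
    [IsLocalization (Algebra.algebraMapSubmonoid R (nonZeroDivisors A)) S]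
    {I : Ideal R} {J : Ideal S} (hIJ : I ≤ J.under R) :
    ringKrullDim (S ⧸ J) + 1 ≤ ringKrullDim (R ⧸ I) := by
  set M := Algebra.algebraMapSubmonoid R (nonZeroDivisors A)
  rw [ringKrullDim_quotient, ringKrullDim_quotient]
  refine krullDim_add_one_le_of_strictMono
    (fun p => ⟨PrimeSpectrum.comap (algebraMap R S) p.1, hIJ.trans (Ideal.comap_mono p.2)⟩)
    (fun p q hpq => (IsLocalization.orderEmbedding M S).strictMono hpq) fun p => ?_
  obtain ⟨hprime, hdisj⟩ := (IsLocalization.isPrime_iff_isPrime_disjoint M S _).1 p.1.isPrime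
  have hbot : (p.1.asIdeal.under R).under A = ⊥ := by
    refine (Submodule.eq_bot_iff _).2 fun a ha => by_contra fun h0 => ?_
    exact Set.disjoint_left.1 hdisj
      (Algebra.mem_algebraMapSubmonoid_of_mem ⟨a, mem_nonZeroDivisors_of_ne_zero h0⟩) ha
  have hnot : ¬ (p.1.asIdeal.under R).IsMaximal := fun _ => by
    have := isMaximal_under_of_finiteType (A := A) (p.1.asIdeal.under R)
    rw [hbot] at this
    exact hA (Ring.isField_iff_maximal_bot.2 this)
  obtain ⟨N, hN, hle⟩ := Ideal.exists_le_maximal _ hprime.ne_top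
  refine ⟨⟨⟨N, hN.isPrime⟩, (hIJ.trans (Ideal.comap_mono p.2)).trans hle⟩,
    lt_of_le_of_ne hle fun h => hnot ?_⟩
  exact (congrArg (fun q => q.1.asIdeal.IsMaximal) h).mpr hN

section MvPolynomial

open MvPolynomial

variable {σ : Type*}

theorem ringKrullDim_quotient_mvPolynomial_add_one_le [IsDomain A] [IsJacobsonRing A] [Finite σ]
    (hA : ¬ IsField A) (K : Type*) [Field K] [Algebra A K] [IsFractionRing A K]
    {I : Ideal (MvPolynomial σ A)} {J : Ideal (MvPolynomial σ K)}
    (hIJ : I ≤ J.comap (MvPolynomial.map (algebraMap A K))) :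
    ringKrullDim (MvPolynomial σ K ⧸ J) + 1 ≤ ringKrullDim (MvPolynomial σ A ⧸ I) := by
  let _ := algebraMvPolynomial (σ := σ) (R := A) (S := K)
  have : IsLocalization
      (Algebra.algebraMapSubmonoid (MvPolynomial σ A) (nonZeroDivisors A)) (MvPolynomial σ K) :=
    MvPolynomial.isLocalization (nonZeroDivisors A) K
  exact ringKrullDim_quotient_add_one_le_of_isLocalization hA hIJ

variable {B C : Type*} [CommRing B] [CommRing C] [Algebra A C]

theorem isIntegral_of_surjective_of_isIntegral_X [Algebra A B] [Algebra B C] [IsScalarTower A B C]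
    {f : MvPolynomial σ A →ₐ[A] C} (hf : Function.Surjective f) (h : ∀ i, IsIntegral B (f (X i))) :
    Algebra.IsIntegral B C := by
  have hle : f.range ≤ (integralClosure B C).restrictScalars A := by
    rw [← Algebra.map_top, ← adjoin_range_X, AlgHom.map_adjoin, Algebra.adjoin_le_iff]
    rintro _ ⟨_, ⟨i, rfl⟩, rfl⟩
    exact h i
  exact ⟨fun c => hle (hf c)⟩

theorem finite_of_surjective_of_X_pow_mem_ker [Finite σ] {f : MvPolynomial σ A →ₐ[A] C}
    (hf : Function.Surjective f) {n : ℕ} (hn : 0 < n) (h : ∀ i, X i ^ n ∈ RingHom.ker f) :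
    Module.Finite A C := by
  have : Algebra.IsIntegral A C := isIntegral_of_surjective_of_isIntegral_X hf fun i => by
    refine IsIntegral.of_pow hn ?_
    rw [← map_pow, RingHom.mem_ker.1 (h i)]
    exact isIntegral_zero
  have : Algebra.FiniteType A C := .of_surjective f hf
  exact Algebra.IsIntegral.finite

/-- Each variable is integral over the subalgebra generated by those in `S`, being a root of the
monic polynomial `(T ∏ s ∈ S, (T - s)) ^ n`. -/
theorem ringKrullDim_le_of_surjective_of_mem_radical_ker [IsNoetherianRing A]
    {f : MvPolynomial σ A →ₐ[A] C} (hf : Function.Surjective f) (S : Finset σ)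
    (h : ∀ x, X x * ∏ s ∈ S, (X x - X s) ∈ (RingHom.ker f).radical) :
    ringKrullDim C ≤ ringKrullDim A + S.card := by
  let g : MvPolynomial S A →ₐ[A] C := f.comp (rename Subtype.val)
  let _ := g.toAlgebra
  have : IsScalarTower A (MvPolynomial S A) C := .of_algebraMap_eq' g.comp_algebraMap.symm
  have hX (s : S) : algebraMap (MvPolynomial S A) C (X s) = f (X s) :=
    congrArg f (rename_X _ _)
  have : Algebra.IsIntegral (MvPolynomial S A) C := by
    refine isIntegral_of_surjective_of_isIntegral_X hf fun x => ?_
    obtain ⟨n, hn⟩ := h x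
    have hmonic : (Polynomial.X * ∏ s : S, (Polynomial.X - Polynomial.C (X s :
        MvPolynomial S A))).Monic :=
      Polynomial.monic_X.mul
        (Polynomial.monic_prod_of_monic _ _ fun s _ => Polynomial.monic_X_sub_C _)
    refine ⟨_, hmonic.pow n, ?_⟩
    rw [RingHom.mem_ker, ← Finset.prod_coe_sort S] at hn
    simpa [Polynomial.eval₂_finsetProd, hX] using hn
  refine (ringKrullDim_le_of_isIntegral (MvPolynomial S A) C).trans_eq ?_
  simp [ringKrullDim_of_isNoetherianRing]

end MvPolynomial

end KrullDimension

section KhovanovRozanskyHomology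

open MvPolynomial

variable {V : Type u} {E : Type w}

theorem polyIncl_X (k : Type) [CommRing k] {F : Set E} (x : F) : polyIncl k F (X x) = X (x : E) :=
  rename_X _ _

theorem polyIncl_comp_map {k l : Type} [CommRing k] [CommRing l] (f : k →+* l) (F : Set E) :
    (polyIncl l F).comp (map f) = (map f).comp (polyIncl k F) :=
  RingHom.ext fun p => (map_rename f _ p).symm

namespace DirectedGraph

theorem NoCycleThrough.deleteEdges {G : DirectedGraph V E} {v : V} (h : G.NoCycleThrough v)
    (S : Set E) : (G.deleteEdges S).NoCycleThrough v := fun ⟨C, hC⟩ =>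
  h ⟨⟨C.n, C.vertex, fun i => C.edge i, C.vertex_injective, C.init_edge, C.term_edge⟩, hC⟩

theorem noCycleThrough_deleteEdges_of_subset {G : DirectedGraph V E} {v : V} {S : Set E}
    (hS : G.incidentEdges v ⊆ S) : (G.deleteEdges S).NoCycleThrough v :=
  fun ⟨C, i, hi⟩ => (C.edge i).2 (hS (Or.inl ((C.init_edge i).trans hi)))

variable [Fintype E] [DecidableEq V] (G : DirectedGraph V E) (v : V)

theorem annZero_eq : G.annZero v = G.incidenceIdeal.comap (polyIncl ℤ (G.incidentEdges v)) :=
  congrArg (Ideal.comap _) annihilator_homology_zero_koszulComplex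

theorem annTotal_eq_annZero : G.annTotal v = G.annZero v :=
  congrArg (Ideal.comap _) (annihilator_directSum_homology_koszulComplex.trans
    annihilator_homology_zero_koszulComplex.symm)

theorem annVia_krHomologyRat_zero_eq :
    annVia (polyIncl ℚ (G.incidentEdges v)) (G.krHomologyRat 0) =
      (G.incidenceIdeal.map (map (Int.castRingHom ℚ))).comap (polyIncl ℚ (G.incidentEdges v)) :=
  congrArg (Ideal.comap _) (annihilator_homology_zero_extendScalars_koszulComplex _)

theorem ker_mkₐ_annZero : RingHom.ker (Ideal.Quotient.mkₐ ℤ (G.annZero v)) =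
    G.incidenceIdeal.comap (polyIncl ℤ (G.incidentEdges v)) :=
  (Ideal.Quotient.mkₐ_ker ℤ _).trans (G.annZero_eq v)

variable {v}

/-- Sending the edges of the `i`-th cycle to the `i`-th variable and all others to `0` satisfies
the incidence relations, because each variable is then taken on a balanced set of edges. -/
theorem natCast_le_kdimRat {k : ℕ} (C : Fin k → DirectedCycle G) (hv : ∀ i, (C i).Contains v)
    (hC : Pairwise fun i j => Disjoint (C i).edgeSet (C j).edgeSet) :
    (k : WithBot ℕ∞) ≤ G.kdimRat v := by
  classical
  let ψ : MvPolynomial E ℚ →ₐ[ℚ] MvPolynomial (Fin k) ℚ := aeval (DirectedCycle.weight C X)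
  have hψ : G.incidenceIdeal.map (map (Int.castRingHom ℚ)) ≤ RingHom.ker ψ := by
    rw [Ideal.map_le_iff_le_comap]
    refine (incidenceIdeal_le_ker_iff_isBalanced
      (φ := ψ.toRingHom.comp (map (Int.castRingHom ℚ)))).2 fun t ht => ?_
    simpa [ψ] using DirectedCycle.isBalanced_weight_eq hC (X_injective (R := ℚ)) ht
  let θ : MvPolynomial (G.incidentEdges v) ℚ →ₐ[ℚ] MvPolynomial (Fin k) ℚ :=
    ψ.comp (rename Subtype.val)
  have hθ : Function.Surjective θ := by
    rw [← AlgHom.range_eq_top, ← top_le_iff, ← adjoin_range_X, Algebra.adjoin_le_iff]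
    rintro _ ⟨i, rfl⟩
    obtain ⟨j, hj⟩ := hv i
    refine ⟨X ⟨(C i).edge j, Or.inl (((C i).init_edge j).trans hj)⟩, ?_⟩
    simp [θ, ψ, DirectedCycle.weight_of_mem hC (i := i) ⟨j, rfl⟩]
  have hker : annVia (polyIncl ℚ (G.incidentEdges v)) (G.krHomologyRat 0) ≤ RingHom.ker θ := by
    rw [annVia_krHomologyRat_zero_eq]
    exact Ideal.comap_mono hψ
  have hdim := ringKrullDim_le_of_surjective (Ideal.Quotient.lift _ θ.toRingHom hker)
    (Ideal.Quotient.lift_surjective_of_surjective _ _ hθ)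
  rw [ringKrullDim_of_isNoetherianRing, ringKrullDim_eq_zero_of_field] at hdim
  simpa [kdimRat, krullDimVia] using hdim

variable (v)

theorem alpha_le_kdimRat : (G.alpha v : WithBot ℕ∞) ≤ G.kdimRat v := by
  have hmem : G.alpha v ∈ {k : ℕ | ∃ C : Fin k → DirectedCycle G,
      (∀ i, (C i).Contains v) ∧ Pairwise fun i j => Disjoint (C i).edgeSet (C j).edgeSet} := by
    refine Nat.sSup_mem ⟨0, fun i => i.elim0, fun i => i.elim0, fun i => i.elim0⟩
      ⟨Fintype.card E, ?_⟩
    rintro k ⟨C, -, hC⟩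
    have hinj : Function.Injective fun i => (C i).edge 0 := fun i j hij => by
      by_contra hne
      exact Set.disjoint_left.1 (hC hne) ⟨0, rfl⟩ ⟨0, hij.symm⟩
    simpa using Fintype.card_le_of_injective _ hinj
  obtain ⟨C, hv, hC⟩ := hmem
  exact G.natCast_le_kdimRat C hv hC

theorem kdimRat_nonneg : 0 ≤ G.kdimRat v :=
  le_trans (Nat.cast_nonneg _) (G.alpha_le_kdimRat v)

theorem kdimRat_add_one_le_kdimInt : G.kdimRat v + 1 ≤ G.kdimInt v := by
  refine ringKrullDim_quotient_mvPolynomial_add_one_le Int.not_isField ℚ ?_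
  change G.annZero v ≤ _
  rw [annVia_krHomologyRat_zero_eq, annZero_eq, algebraMap_int_eq, Ideal.comap_comap,
    polyIncl_comp_map, ← Ideal.comap_comap]
  exact Ideal.comap_mono Ideal.le_comap_map

variable {G v}

theorem noCycleThrough_of_kdimRat_eq_zero (h : G.kdimRat v = 0) : G.NoCycleThrough v := by
  rintro ⟨C, hC⟩
  have hone : ((1 : ℕ) : WithBot ℕ∞) ≤ G.kdimRat v :=
    G.natCast_le_kdimRat (fun _ => C) (fun _ => hC) (Subsingleton.pairwise)
  rw [h] at hone
  exact absurd hone (by norm_num)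

theorem kdimRat_eq_zero_of_kdimInt_eq_one (h : G.kdimInt v = 1) : G.kdimRat v = 0 := by
  have hle : G.kdimRat v + 1 ≤ 0 + 1 :=
    (G.kdimRat_add_one_le_kdimInt v).trans_eq (h.trans (zero_add 1).symm)
  exact (ENat.WithBot.add_le_add_one_right_iff.1 hle).antisymm (G.kdimRat_nonneg v)

theorem kdimInt_eq_one_of_finite
    (h : Module.Finite ℤ (MvPolynomial (G.incidentEdges v) ℤ ⧸ G.annZero v)) :
    G.kdimInt v = 1 := by
  refine le_antisymm ?_ ?_
  · rw [← IsPrincipalIdealRing.ringKrullDim_eq_one ℤ Int.not_isField]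
    exact ringKrullDim_le_of_isIntegral ℤ (MvPolynomial (G.incidentEdges v) ℤ ⧸ G.annZero v)
  · calc (1 : WithBot ℕ∞) = 0 + 1 := (zero_add 1).symm
      _ ≤ G.kdimRat v + 1 := add_le_add_left (G.kdimRat_nonneg v) 1
      _ ≤ G.kdimInt v := G.kdimRat_add_one_le_kdimInt v

theorem finite_quotient_annZero_of_X_pow_mem {n : ℕ} (hn : 0 < n)
    (h : ∀ x ∈ G.incidentEdges v, (X x : MvPolynomial E ℤ) ^ n ∈ G.incidenceIdeal) :
    Module.Finite ℤ (MvPolynomial (G.incidentEdges v) ℤ ⧸ G.annZero v) := by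
  refine finite_of_surjective_of_X_pow_mem_ker (Ideal.Quotient.mkₐ_surjective ℤ _) hn fun x => ?_
  rw [ker_mkₐ_annZero, Ideal.mem_comap, map_pow, polyIncl_X]
  exact h x x.2

theorem NoCycleThrough.exists_X_pow_mem (h : G.NoCycleThrough v) :
    ∃ n : ℕ, 1 ≤ n ∧ ∀ x ∈ G.incidentEdges v,
      (X x : MvPolynomial E ℤ) ^ n ∈ G.incidenceIdeal := by
  obtain ⟨n, hn⟩ := Ideal.exists_radical_pow_le_of_fg G.incidenceIdeal (IsNoetherian.noetherian _)
  refine ⟨n + 1, n.succ_pos, fun x hx => ?_⟩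
  have hrad : X x ∈ G.incidenceIdeal.radical := by
    simpa using X_mul_prod_sub_mem_radical (S := ∅) (h.deleteEdges _) hx
  exact (Ideal.pow_le_pow_right n.le_succ).trans hn (Ideal.pow_mem_pow hrad (n + 1))

theorem kdimInt_le_card_add_one {S : Finset E} (hSv : (S : Set E) ⊆ G.incidentEdges v)
    (hS : (G.deleteEdges (S : Set E)).NoCycleThrough v) :
    G.kdimInt v ≤ (S.card : WithBot ℕ∞) + 1 := by
  classical
  have hcard : (S.subtype (· ∈ G.incidentEdges v)).card = S.card := by
    rw [Finset.card_subtype, Finset.filter_true_of_mem fun x hx => hSv hx]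
  rw [← hcard, add_comm, ← IsPrincipalIdealRing.ringKrullDim_eq_one ℤ Int.not_isField]
  refine ringKrullDim_le_of_surjective_of_mem_radical_ker
    (Ideal.Quotient.mkₐ_surjective ℤ (G.annZero v)) _ fun x => ?_
  rw [ker_mkₐ_annZero, ← Ideal.comap_radical, Ideal.mem_comap]
  have hprod : ∏ s ∈ S.subtype (· ∈ G.incidentEdges v), (X (x : E) - X (s : E)) =
      ∏ s ∈ S, (X (x : E) - X s : MvPolynomial E ℤ) :=
    Finset.prod_subtype_of_mem (fun s => (X (x : E) - X s : MvPolynomial E ℤ)) hSv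
  simp only [map_mul, map_prod, map_sub, polyIncl_X, hprod]
  exact X_mul_prod_sub_mem_radical hS x.2

variable (G v)

theorem kdimInt_le_beta_add_one : G.kdimInt v ≤ (G.beta v : WithBot ℕ∞) + 1 := by
  classical
  have hmem : G.beta v ∈ {k : ℕ | ∃ S : Finset E, (S : Set E) ⊆ G.incidentEdges v ∧ S.card = k ∧
      (G.deleteEdges (S : Set E)).NoCycleThrough v} :=
    Nat.sInf_mem ⟨_, (G.incidentEdges v).toFinset, by simp, rfl,
      noCycleThrough_deleteEdges_of_subset (by simp)⟩
  obtain ⟨S, hSv, hcard, hS⟩ := hmem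
  rw [← hcard]
  exact kdimInt_le_card_add_one hSv hS

end DirectedGraph

end KhovanovRozanskyHomology

theorem mainTheorem5_general {V : Type u} {E : Type w} [Fintype E] [DecidableEq V]
    (G : DirectedGraph V E) (v : V) :
    List.TFAE [
      G.NoCycleThrough v,
      Module.Finite ℤ (MvPolynomial (G.incidentEdges v) ℤ ⧸ G.annZero v),
      Module.Finite ℤ (MvPolynomial (G.incidentEdges v) ℤ ⧸ G.annTotal v),
      ∃ n : ℕ, 1 ≤ n ∧ ∀ x ∈ G.incidentEdges v,
        (MvPolynomial.X x : MvPolynomial E ℤ) ^ n ∈ G.incidenceIdeal,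
      G.kdimInt v = 1,
      G.kdimRat v = 0] ∧
    (G.alpha v : WithBot ℕ∞) ≤ G.kdimRat v ∧
    G.kdimRat v + 1 ≤ G.kdimInt v ∧
    G.kdimInt v ≤ (G.beta v : WithBot ℕ∞) + 1 := by
  refine ⟨?_, G.alpha_le_kdimRat v, G.kdimRat_add_one_le_kdimInt v, G.kdimInt_le_beta_add_one v⟩
  rw [G.annTotal_eq_annZero v]
  tfae_have 1 → 4 := fun h => h.exists_X_pow_mem
  tfae_have 4 → 2 := fun ⟨_, hn, h⟩ => DirectedGraph.finite_quotient_annZero_of_X_pow_mem hn h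
  tfae_have 2 ↔ 3 := Iff.rfl
  tfae_have 2 → 5 := DirectedGraph.kdimInt_eq_one_of_finite
  tfae_have 5 → 6 := DirectedGraph.kdimRat_eq_zero_of_kdimInt_eq_one
  tfae_have 6 → 1 := DirectedGraph.noCycleThrough_of_kdimRat_eq_zero
  tfae_finish

theorem mainTheorem5 {V : Type u} {E : Type w} [Fintype V] [Fintype E] [DecidableEq V]
    (G : DirectedGraph V E) (v : V) :
    List.TFAE [
      G.NoCycleThrough v,
      Module.Finite ℤ (MvPolynomial (G.incidentEdges v) ℤ ⧸ G.annZero v),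
      Module.Finite ℤ (MvPolynomial (G.incidentEdges v) ℤ ⧸ G.annTotal v),
      ∃ n : ℕ, 1 ≤ n ∧ ∀ x ∈ G.incidentEdges v,
        (MvPolynomial.X x : MvPolynomial E ℤ) ^ n ∈ G.incidenceIdeal,
      G.kdimInt v = 1,
      G.kdimRat v = 0] ∧
    (G.alpha v : WithBot ℕ∞) ≤ G.kdimRat v ∧
    G.kdimRat v + 1 ≤ G.kdimInt v ∧
    G.kdimInt v ≤ (G.beta v : WithBot ℕ∞) + 1 :=
  mainTheorem5_general G v
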